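/- Let $n\ge 0$ and let $P$ be a convex polygon with $n+3$ vertices, labelled $1,\dots,n+3$ in cyclic order. Fix a triangulation $T$ of $P$, that is, a maximal set of pairwise noncrossing diagonals, and let $\mathbb{Q}(x_e)$ be the field of rational functions in one indeterminate $x_e$ for each diagonal $e$ of $T$ (the initial cluster variables) and each boundary edge $e$ of $P$ (the frozen variables). Starting from $T$, perform diagonal flips: whenever $p,q,r,t$ are the consecutive vertices of a quadrilateral whose sides are diagonals of the current triangulation or boundary edges, the diagonal $pr$ of the triangulation may be replaced by $qt$, with the new variable $x_{qt}$ given by the exchange relation $$x_{pr}\,x_{qt}=x_{pq}\,x_{rt}+x_{qr}\,x_{tp}.$$ The elements $x_\alpha\in\mathbb{Q}(x_e)$ attached in this way to the diagonals $\alpha$ of $P$ are the cluster variables of the type-$A_n$ cluster algebra $\mathcal{A}$ (each diagonal $\alpha$ has exactly one cluster variable $x_\alpha$). The exchange module $E(\mathcal{A})$ is the $\mathbb{Z}$-submodule of $\mathbb{Q}(x_e)$ spanned by all differences $x_\alpha-x_\beta$, where $\alpha$ and $\beta$ are crossing diagonals of $P$. Then $E(\mathcal{A})$ is a free $\mathbb{Z}$-module,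 and it is generated by the set $$\{\,x_\alpha-x_\beta : \alpha,\beta \text{ crossing diagonals of } P,\ \alpha \text{ has vertex } 1 \text{ as an endpoint}\,\}.$$ Moreover, this generating set has exactly $\binom{n+2}{3}$ elements. (It is not asserted that this set is a basis, or a minimal generating set, of $E(\mathcal{A})$.) -/

import Mathlib

namespace TypeA

/-- Two chords of the convex polygon with vertices `0, …, m - 1` (in this cyclic order) cross if
their four endpoints are distinct and interlace. -/
def Crosses {m : ℕ} (α β : Sym2 (Fin m)) : Prop :=
  ∃ a b c d : Fin m, a < b ∧ b < c ∧ c < d ∧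
    ((α = s(a, c) ∧ β = s(b, d)) ∨ (α = s(b, d) ∧ β = s(a, c)))

/-- The boundary edges of the `(n + 3)`-gon; addition in `Fin (n + 3)` is cyclic. -/
def IsSide {n : ℕ} (e : Sym2 (Fin (n + 3))) : Prop :=
  ∃ i : Fin (n + 3), e = s(i, i + 1)

/-- The diagonals of the `(n + 3)`-gon: chords with two distinct endpoints that are not boundary
edges. -/
def IsDiagonal {n : ℕ} (e : Sym2 (Fin (n + 3))) : Prop :=
  ¬ e.IsDiag ∧ ¬ IsSide e

/-- A triangulation of the `(n + 3)`-gon: a maximal set of pairwise noncrossing diagonals. -/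
def IsTriangulation {n : ℕ} (T : Set (Sym2 (Fin (n + 3)))) : Prop :=
  Maximal (fun S : Set (Sym2 (Fin (n + 3))) =>
    (∀ e ∈ S, IsDiagonal e) ∧ ∀ e ∈ S, ∀ f ∈ S, ¬ Crosses e f) T

/-- The field of rational functions over `ℚ` in one indeterminate for each diagonal of `T` and
each boundary edge of the polygon. -/
abbrev AmbientField {n : ℕ} (T : Set (Sym2 (Fin (n + 3)))) : Type :=
  FractionRing (MvPolynomial {e : Sym2 (Fin (n + 3)) // e ∈ T ∨ IsSide e} ℚ)

open Classical in
/-- The variables of the initial seed: the indeterminate `x_e` for each diagonal `e` of `T` and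
each boundary edge `e`. (The value at other chords is never used.) -/
noncomputable def initialVars {n : ℕ} (T : Set (Sym2 (Fin (n + 3)))) :
    Sym2 (Fin (n + 3)) → AmbientField T :=
  fun e => if h : e ∈ T ∨ IsSide e then
    algebraMap (MvPolynomial {e : Sym2 (Fin (n + 3)) // e ∈ T ∨ IsSide e} ℚ) (AmbientField T)
      (MvPolynomial.X ⟨e, h⟩)
  else 0

/-- `IsSeed T S f` says that the triangulation `S`, with the variable `f e` attached to each
diagonal `e` of `S` (a cluster variable) and each boundary edge `e` (a frozen variable), is reached
from the initial seed of `T` by finitely many diagonal flips. A flip inside a quadrilateral with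
consecutive vertices `p, q, r, t`, whose four sides are diagonals of `S` or boundary edges,
replaces the diagonal `pr` by `qt`; the new variable is determined by the exchange relation
`x_{pr} x_{qt} = x_{pq} x_{rt} + x_{qr} x_{tp}`, and all the other variables are kept.
The values of `f` at chords that are neither in `S` nor boundary edges play no role. -/
inductive IsSeed {n : ℕ} (T : Set (Sym2 (Fin (n + 3)))) :
    Set (Sym2 (Fin (n + 3))) → (Sym2 (Fin (n + 3)) → AmbientField T) → Prop
  | initial : IsSeed T T (initialVars T)
  | flip (S : Set (Sym2 (Fin (n + 3)))) (f : Sym2 (Fin (n + 3)) → AmbientField T)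
      (p q r t : Fin (n + 3)) (hS : IsSeed T S f)
      (hcross : Crosses s(p, r) s(q, t)) (hpr : s(p, r) ∈ S)
      (hpq : s(p, q) ∈ S ∨ IsSide s(p, q)) (hqr : s(q, r) ∈ S ∨ IsSide s(q, r))
      (hrt : s(r, t) ∈ S ∨ IsSide s(r, t)) (htp : s(t, p) ∈ S ∨ IsSide s(t, p)) :
      IsSeed T (insert s(q, t) (S \ {s(p, r)}))
        (Function.update f s(q, t)
          ((f s(p, q) * f s(r, t) + f s(q, r) * f s(t, p)) / f s(p, r)))

/-- `u` is a cluster variable `x_α` of the diagonal `α` : the variable attached to `α` in some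
seed whose triangulation contains `α`. -/
def IsClusterVariable {n : ℕ} (T : Set (Sym2 (Fin (n + 3)))) (α : Sym2 (Fin (n + 3)))
    (u : AmbientField T) : Prop :=
  ∃ (S : Set (Sym2 (Fin (n + 3)))) (f : Sym2 (Fin (n + 3)) → AmbientField T),
    IsSeed T S f ∧ α ∈ S ∧ u = f α

/-- The set of all differences `x_α - x_β` with `α` and `β` crossing diagonals. -/
def exchangeDifferences {n : ℕ} (T : Set (Sym2 (Fin (n + 3)))) : Set (AmbientField T) :=
  {w | ∃ (α β : Sym2 (Fin (n + 3))) (u v : AmbientField T), Crosses α β ∧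
    IsClusterVariable T α u ∧ IsClusterVariable T β v ∧ w = u - v}

/-- The exchange module of the type-`A_n` cluster algebra: the `ℤ`-span of the differences
`x_α - x_β` over all pairs of crossing diagonals. -/
noncomputable def exchangeModule {n : ℕ} (T : Set (Sym2 (Fin (n + 3)))) :
    Submodule ℤ (AmbientField T) :=
  Submodule.span ℤ (exchangeDifferences T)

/-- The differences `x_α - x_β` with `α` and `β` crossing diagonals such that the first vertex of
the polygon (`0 : Fin (n + 3)`) is an endpoint of `α`. -/
def firstVertexDifferences {n : ℕ} (T : Set (Sym2 (Fin (n + 3)))) : Set (AmbientField T) :=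
  {w | ∃ (α β : Sym2 (Fin (n + 3))) (u v : AmbientField T), (0 : Fin (n + 3)) ∈ α ∧ Crosses α β ∧
    IsClusterVariable T α u ∧ IsClusterVariable T β v ∧ w = u - v}

end TypeA

namespace TypeA

/-! Once each diagonal has a single variable `x α`, generation is a telescoping identity: for `0 < a
< b < c < d`, `x_ac - x_bd` is a signed sum of four differences with an end at `0`
(`span_firstVertexDifferences`). Those differences are indexed by triples of the other `n + 2`
vertices, so the generating set is finite; a finitely generated submodule of a field of
characteristic zero is torsion-free, hence free over `ℤ`.

The real work is that variables exist and do not depend on the flips, and that distinct triples give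
distinct differences. Existence follows from flip-connectivity through the fan at `0` (`reach_fan`,
`exists_reach_of_fan`). For the rest, variables are evaluated at positive chord lengths satisfying
all Ptolemy relations: by `IsSeed.hasValue` the value at `α` is its length, whatever the flips. All
positive initial data extend to such lengths (`extendable`), which gives uniqueness; the lengths `4
^ j - 4 ^ i` separate the differences. -/

/-! ### Crossing chords and quadrilaterals -/

theorem crosses_mk {m : ℕ} {p q r t : Fin m} : Crosses s(p, r) s(q, t) ↔
    (p < q ∧ q < r ∧ r < t) ∨ (p < t ∧ t < r ∧ r < q) ∨
    (r < q ∧ q < p ∧ p < t) ∨ (r < t ∧ t < p ∧ p < q) ∨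
    (q < p ∧ p < t ∧ t < r) ∨ (q < r ∧ r < t ∧ t < p) ∨
    (t < p ∧ p < q ∧ q < r) ∨ (t < r ∧ r < q ∧ q < p) := by
  constructor
  · rintro ⟨a, b, c, d, hab, hbc, hcd, ⟨h1, h2⟩ | ⟨h1, h2⟩⟩ <;>
    · rw [Sym2.eq_iff] at h1 h2
      rcases h1 with ⟨rfl, rfl⟩ | ⟨rfl, rfl⟩ <;> rcases h2 with ⟨rfl, rfl⟩ | ⟨rfl, rfl⟩ <;>
        simp only [hab, hbc, hcd, and_self, true_or, or_true]
  · rintro (h | h | h | h | h | h | h | h)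
    · exact ⟨p, q, r, t, h.1, h.2.1, h.2.2, .inl ⟨rfl, rfl⟩⟩
    · exact ⟨p, t, r, q, h.1, h.2.1, h.2.2, .inl ⟨rfl, Sym2.eq_swap⟩⟩
    · exact ⟨r, q, p, t, h.1, h.2.1, h.2.2, .inl ⟨Sym2.eq_swap, rfl⟩⟩
    · exact ⟨r, t, p, q, h.1, h.2.1, h.2.2, .inl ⟨Sym2.eq_swap, Sym2.eq_swap⟩⟩
    · exact ⟨q, p, t, r, h.1, h.2.1, h.2.2, .inr ⟨rfl, rfl⟩⟩
    · exact ⟨q, r, t, p, h.1, h.2.1, h.2.2, .inr ⟨Sym2.eq_swap, rfl⟩⟩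
    · exact ⟨t, p, q, r, h.1, h.2.1, h.2.2, .inr ⟨rfl, Sym2.eq_swap⟩⟩
    · exact ⟨t, r, q, p, h.1, h.2.1, h.2.2, .inr ⟨Sym2.eq_swap, Sym2.eq_swap⟩⟩

theorem crosses_mk_of_lt {m : ℕ} {p q r t : Fin m} (hpr : p < r) (hqt : q < t) :
    Crosses s(p, r) s(q, t) ↔ (p < q ∧ q < r ∧ r < t) ∨ (q < p ∧ p < t ∧ t < r) := by
  rw [crosses_mk]
  constructor
  · rintro (h | h | h | h | h | h | h | h) <;> simp only [Fin.lt_def] at * <;> omega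
  · rintro (h | h)
    · exact .inl h
    · exact .inr (.inr (.inr (.inr (.inl h))))

theorem Crosses.symm {m : ℕ} {α β : Sym2 (Fin m)} (h : Crosses α β) : Crosses β α := by
  obtain ⟨a, b, c, d, hab, hbc, hcd, h⟩ := h
  exact ⟨a, b, c, d, hab, hbc, hcd, h.symm.imp And.symm And.symm⟩

theorem isSide_mk_of_lt {n : ℕ} {x y : Fin (n + 3)} (h : x < y) :
    IsSide s(x, y) ↔ y.val = x.val + 1 ∨ (x.val = 0 ∧ y.val = n + 2) := by
  have key : ∀ i : Fin (n + 3), (i + 1).val = if i.val = n + 2 then 0 else i.val + 1 := by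
    intro i
    rw [Fin.val_add_one]
    simp [Fin.ext_iff]
  rw [Fin.lt_def] at h
  constructor
  · rintro ⟨i, hi⟩
    have := key i
    rw [Sym2.eq_iff, Fin.ext_iff, Fin.ext_iff, Fin.ext_iff, Fin.ext_iff] at hi
    split_ifs at this <;> omega
  · rintro (h1 | ⟨h1, h2⟩)
    · refine ⟨x, ?_⟩
      rw [Sym2.eq_iff, Fin.ext_iff, Fin.ext_iff, Fin.ext_iff, Fin.ext_iff, key, if_neg (by omega)]
      omega
    · refine ⟨y, ?_⟩
      rw [Sym2.eq_iff, Fin.ext_iff, Fin.ext_iff, Fin.ext_iff, Fin.ext_iff, key, if_pos h2]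
      omega

theorem isDiagonal_mk_of_lt {n : ℕ} {x y : Fin (n + 3)} (h : x < y) :
    IsDiagonal s(x, y) ↔ x.val + 1 < y.val ∧ ¬ (x.val = 0 ∧ y.val = n + 2) := by
  rw [IsDiagonal, isSide_mk_of_lt h, Sym2.mk_isDiag_iff]
  rw [Fin.lt_def] at h
  rw [Fin.ext_iff]
  omega

/-- Case distinction on the ordered endpoints of a chord. -/
theorem exists_mk_of_not_isDiag {m : ℕ} {e : Sym2 (Fin m)} (h : ¬ e.IsDiag) :
    ∃ x y, x < y ∧ e = s(x, y) := by
  induction e with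
  | _ x y =>
    rw [Sym2.mk_isDiag_iff] at h
    rcases lt_or_gt_of_ne h with h | h
    · exact ⟨x, y, h, rfl⟩
    · exact ⟨y, x, h, Sym2.eq_swap⟩

theorem IsSide.not_isDiag {n : ℕ} {e : Sym2 (Fin (n + 3))} (h : IsSide e) : ¬ e.IsDiag := by
  obtain ⟨i, rfl⟩ := h
  rw [Sym2.mk_isDiag_iff]
  simp

theorem Crosses.isDiagonal_left {n : ℕ} {α β : Sym2 (Fin (n + 3))} (h : Crosses α β) :
    IsDiagonal α := by
  obtain ⟨a, b, c, d, hab, hbc, hcd, ⟨rfl, rfl⟩ | ⟨rfl, rfl⟩⟩ := h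
  · rw [isDiagonal_mk_of_lt (hab.trans hbc)]
    simp only [Fin.lt_def] at *
    omega
  · rw [isDiagonal_mk_of_lt (hbc.trans hcd)]
    simp only [Fin.lt_def] at *
    omega

/-- A chord that meets the interior of a quadrilateral but crosses no side cannot leave it, so it
ends at two of its vertices. -/
theorem eq_of_crosses_of_lt {m : ℕ} {a b c d : Fin m} {e : Sym2 (Fin m)}
    (hab : a < b) (hbc : b < c) (hcd : c < d) (hne : ¬ e.IsDiag) (h1 : ¬ Crosses e s(a, b))
    (h2 : ¬ Crosses e s(b, c)) (h3 : ¬ Crosses e s(c, d)) (h4 : ¬ Crosses e s(a, d)) :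
    (Crosses e s(a, c) → e = s(b, d)) ∧ (Crosses e s(b, d) → e = s(a, c)) := by
  obtain ⟨x, y, hxy, rfl⟩ := exists_mk_of_not_isDiag hne
  have hac := hab.trans hbc
  have hbd := hbc.trans hcd
  rw [crosses_mk_of_lt hxy hab] at h1
  rw [crosses_mk_of_lt hxy hbc] at h2
  rw [crosses_mk_of_lt hxy hcd] at h3
  rw [crosses_mk_of_lt hxy (hac.trans hcd)] at h4
  rw [crosses_mk_of_lt hxy hac, crosses_mk_of_lt hxy hbd, Sym2.eq_iff, Sym2.eq_iff]
  simp only [Fin.lt_def, Fin.ext_iff] at *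
  omega

/-- A chord that crosses one diagonal of a quadrilateral and none of its sides is the other
diagonal. -/
theorem eq_of_crosses_of_not_crosses {m : ℕ} {p q r t : Fin m} {e : Sym2 (Fin m)}
    (h : Crosses s(p, r) s(q, t)) (he : Crosses e s(p, r)) (hne : ¬ e.IsDiag)
    (h1 : ¬ Crosses e s(p, q))
    (h2 : ¬ Crosses e s(q, r)) (h3 : ¬ Crosses e s(r, t)) (h4 : ¬ Crosses e s(t, p)) :
    -- Sorting the vertices below may reverse a side, so each hypothesis is kept in both
    -- orientations for `assumption`.
    e = s(q, t) := by
  have h1' := h1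
  have h2' := h2
  have h3' := h3
  have h4' := h4
  have he' := he
  rw [Sym2.eq_swap] at h1' h2' h3' h4' he'
  rw [crosses_mk] at h
  rcases h with ⟨ha, hb, hc⟩ | ⟨ha, hb, hc⟩ | ⟨ha, hb, hc⟩ | ⟨ha, hb, hc⟩ | ⟨ha, hb, hc⟩ |
    ⟨ha, hb, hc⟩ | ⟨ha, hb, hc⟩ | ⟨ha, hb, hc⟩ <;>
  · have key := eq_of_crosses_of_lt ha hb hc hne (by assumption) (by assumption) (by assumption)
      (by assumption)
    first
    | exact key.1 (by assumption)
    | exact key.2 (by assumption)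
    | exact (key.1 (by assumption)).trans Sym2.eq_swap
    | exact (key.2 (by assumption)).trans Sym2.eq_swap

/-! ### Flips of triangulations -/

/-- The triangulation `S'` arises from `S` by a flip. -/
def Flip {n : ℕ} (S S' : Set (Sym2 (Fin (n + 3)))) : Prop :=
  ∃ p q r t : Fin (n + 3), Crosses s(p, r) s(q, t) ∧ s(p, r) ∈ S ∧
    (s(p, q) ∈ S ∨ IsSide s(p, q)) ∧ (s(q, r) ∈ S ∨ IsSide s(q, r)) ∧
    (s(r, t) ∈ S ∨ IsSide s(r, t)) ∧ (s(t, p) ∈ S ∨ IsSide s(t, p)) ∧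
    S' = insert s(q, t) (S \ {s(p, r)})

theorem Crosses.irrefl {m : ℕ} (e : Sym2 (Fin m)) : ¬ Crosses e e := by
  induction e with
  | _ x y =>
    rw [crosses_mk]
    simp only [Fin.lt_def]
    omega

theorem not_crosses_of_isSide {n : ℕ} {e f : Sym2 (Fin (n + 3))} (h : IsSide f) :
    ¬ Crosses e f := fun hc => hc.symm.isDiagonal_left.2 h

theorem IsTriangulation.not_crosses {n : ℕ} {T : Set (Sym2 (Fin (n + 3)))}
    (hT : IsTriangulation T) {e f : Sym2 (Fin (n + 3))} (he : e ∈ T) (hf : f ∈ T ∨ IsSide f) :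
    ¬ Crosses e f := by
  rcases hf with hf | hf
  · exact hT.prop.2 e he f hf
  · exact not_crosses_of_isSide hf

/-- A chord crossing no diagonal of a triangulation belongs to it. -/
theorem IsTriangulation.mem_of_not_crosses {n : ℕ} {T : Set (Sym2 (Fin (n + 3)))}
    (hT : IsTriangulation T) {e : Sym2 (Fin (n + 3))} (he : IsDiagonal e)
    (h : ∀ f ∈ T, ¬ Crosses e f) : e ∈ T := by
  refine hT.le_of_ge (y := insert e T) ⟨?_, ?_⟩ (Set.subset_insert _ _) (Set.mem_insert _ _)
  · rintro f (rfl | hf)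
    · exact he
    · exact hT.prop.1 f hf
  · rintro f (rfl | hf) g (rfl | hg)
    · exact Crosses.irrefl _
    · exact h g hg
    · exact fun hc => h f hf hc.symm
    · exact hT.prop.2 f hf g hg

/-- The quadrilateral lemma is used twice: an old chord crossing `qt` would have to be `pr`, and a
chord of a larger noncrossing set either crosses `pr`, so is `qt`, or is compatible with all of `T`,
so lies in `T`. -/
theorem IsTriangulation.flip {n : ℕ} {T T' : Set (Sym2 (Fin (n + 3)))}
    (hT : IsTriangulation T) (h : Flip T T') : IsTriangulation T' := by
  obtain ⟨p, q, r, t, hc, hpr, hpq, hqr, hrt, htp, rfl⟩ := h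
  have key : ∀ f ∈ T \ {s(p, r)}, ¬ Crosses f s(q, t) := by
    rintro f ⟨hf, hne⟩ hcf
    have hc' : Crosses s(q, t) s(r, p) := by rw [Sym2.eq_swap (a := r)]; exact hc.symm
    refine hne ?_
    rw [Set.mem_singleton_iff, Sym2.eq_swap (a := p)]
    exact eq_of_crosses_of_not_crosses hc' hcf (hT.prop.1 f hf).1 (hT.not_crosses hf hqr)
      (hT.not_crosses hf hrt)
      (hT.not_crosses hf htp) (hT.not_crosses hf hpq)
  refine ⟨⟨?_, ?_⟩, ?_⟩
  · rintro f (rfl | hf)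
    · exact hc.symm.isDiagonal_left
    · exact hT.prop.1 f hf.1
  · rintro f (rfl | hf) g (rfl | hg)
    · exact Crosses.irrefl _
    · exact fun h => key g hg h.symm
    · exact key f hf
    · exact hT.prop.2 f hf.1 g hg.1
  · rintro U ⟨hU1, hU2⟩ hle e he
    have side : ∀ f, f ≠ s(p, r) → (f ∈ T ∨ IsSide f) → ¬ Crosses e f := by
      rintro f hne (hf | hf)
      · exact hU2 e he f (hle (.inr ⟨hf, hne⟩))
      · exact not_crosses_of_isSide hf
    have hne : s(p, q) ≠ s(p, r) ∧ s(q, r) ≠ s(p, r) ∧ s(r, t) ≠ s(p, r) ∧ s(t, p) ≠ s(p, r) := by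
      rw [crosses_mk] at hc
      simp only [ne_eq, Sym2.eq_iff, Fin.lt_def, Fin.ext_iff] at hc ⊢
      omega
    by_cases hcr : Crosses e s(p, r)
    · left
      exact eq_of_crosses_of_not_crosses hc hcr (hU1 e he).1 (side _ hne.1 hpq) (side _ hne.2.1 hqr)
        (side _ hne.2.2.1 hrt) (side _ hne.2.2.2 htp)
    · right
      refine ⟨hT.mem_of_not_crosses (hU1 e he) fun f hf => ?_, ?_⟩
      · by_cases hfe : f = s(p, r)
        · exact hfe ▸ hcr
        · exact side f hfe (.inl hf)
      · rintro rfl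
        exact hU2 _ he _ (hle (.inl rfl)) hc

/-! ### Every triangulation can be flipped to the fan -/

/-- The fan triangulation at the vertex `0`. -/
def fan (n : ℕ) : Set (Sym2 (Fin (n + 3))) := {e | IsDiagonal e ∧ 0 ∈ e}

/-- A chord of a triangulation that is not a side of the form `s(a, a + 1)` has a triangle on the
side away from the edge `s(0, n + 2)`. -/
theorem IsTriangulation.exists_triangle {n : ℕ} {T : Set (Sym2 (Fin (n + 3)))}
    (hT : IsTriangulation T) {a b : Fin (n + 3)} (hab : a.val + 1 < b.val) (h : s(a, b) ∈ T) :
    ∃ c, a < c ∧ c < b ∧ (s(a, c) ∈ T ∨ IsSide s(a, c)) ∧ (s(c, b) ∈ T ∨ IsSide s(c, b)) := by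
  classical
  let A : Finset (Fin (n + 3)) := {c | a < c ∧ c < b ∧ (s(a, c) ∈ T ∨ IsSide s(a, c))}
  have hne : A.Nonempty := by
    refine ⟨⟨a.val + 1, by omega⟩, ?_⟩
    simp only [A, Finset.mem_filter, Finset.mem_univ, true_and]
    refine ⟨by simp [Fin.lt_def], by simpa [Fin.lt_def] using hab, .inr ?_⟩
    rw [isSide_mk_of_lt (by simp [Fin.lt_def])]
    simp
  -- With `c` the last neighbour of `a` before `b`, a diagonal crossing `cb` but neither `ab` nor
  -- `ac` would join `a` to a vertex beyond `c`.
  obtain ⟨c, hc, hmax⟩ := A.exists_max_image id hne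
  simp only [A, Finset.mem_filter, Finset.mem_univ, true_and, id] at hc hmax
  refine ⟨c, hc.1, hc.2.1, hc.2.2, ?_⟩
  rw [or_iff_not_imp_right]
  intro hside
  refine hT.mem_of_not_crosses ⟨?_, hside⟩ fun f hf hcr => ?_
  · rw [Sym2.mk_isDiag_iff]; exact hc.2.1.ne
  obtain ⟨x, y, hxy, rfl⟩ := exists_mk_of_not_isDiag (hT.prop.1 f hf).1
  have h1 := hT.not_crosses hf (.inl h)
  have h2 := hT.not_crosses hf hc.2.2
  have hab' : a < b := hc.1.trans hc.2.1
  rw [crosses_mk_of_lt hxy hab'] at h1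
  rw [crosses_mk_of_lt hxy hc.1] at h2
  rw [crosses_mk_of_lt hc.2.1 hxy] at hcr
  have hxa : x = a ∧ c < y ∧ y < b := by
    have := hc.1
    simp only [Fin.lt_def, Fin.ext_iff] at *
    omega
  obtain ⟨rfl, hcy, hyb⟩ := hxa
  exact absurd (hmax y ⟨hxy, hyb, .inl hf⟩) (not_le.2 hcy)

/-- The measure for the flips towards the fan at `0`. -/
noncomputable def fanDefect {n : ℕ} (T : Set (Sym2 (Fin (n + 3)))) : ℕ :=
  {i : Fin (n + 3) | s(0, i) ∉ T}.ncard

/-- A diagonal `xy` with `0 < x < y` crosses the spoke from `0` to `x + 1`. -/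
theorem IsTriangulation.eq_fan {n : ℕ} {T : Set (Sym2 (Fin (n + 3)))}
    (hT : IsTriangulation T) (h : fan n ⊆ T) : T = fan n := by
  refine Set.Subset.antisymm (fun e he => ⟨hT.prop.1 e he, ?_⟩) h
  have hd := hT.prop.1 e he
  obtain ⟨x, y, hxy, rfl⟩ := exists_mk_of_not_isDiag hd.1
  by_contra hmem
  rw [Sym2.mem_iff, not_or] at hmem
  rw [isDiagonal_mk_of_lt hxy] at hd
  simp only [Fin.ext_iff, Fin.val_zero] at hmem
  have hlt : (0 : Fin (n + 3)) < ⟨x.val + 1, by omega⟩ := by simp [Fin.lt_def]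
  have hm : s(0, ⟨x.val + 1, by omega⟩) ∈ fan n := by
    refine ⟨?_, Sym2.mem_mk_left _ _⟩
    rw [isDiagonal_mk_of_lt hlt]
    simp only [Fin.val_zero]
    omega
  refine hT.prop.2 _ he _ (h hm) ?_
  rw [crosses_mk_of_lt hxy hlt]
  simp only [Fin.lt_def, Fin.val_zero] at *
  omega

/-- Let `0k` be a missing spoke and `a < k < b` the nearest neighbours of `0` on either side. Then
`ab` is in `T`, since a diagonal crossing it would be a spoke strictly between them. Flipping `ab`
gains a spoke and loses none. -/
theorem IsTriangulation.exists_flip {n : ℕ} {T : Set (Sym2 (Fin (n + 3)))}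
    (hT : IsTriangulation T) (h : ¬ fan n ⊆ T) : ∃ T', Flip T T' ∧ fanDefect T' < fanDefect T := by
  classical
  obtain ⟨e, ⟨hed, he0⟩, heT⟩ := Set.not_subset.1 h
  obtain ⟨k, rfl⟩ := he0
  have hk0 : (0 : Fin (n + 3)) < k := by
    have := hed.1
    rw [Sym2.mk_isDiag_iff] at this
    exact Fin.pos_iff_ne_zero.2 (Ne.symm this)
  let N : Finset (Fin (n + 3)) := {c | 0 < c ∧ (s(0, c) ∈ T ∨ IsSide s(0, c))}
  have hkN : k ∉ N := by
    simp only [N, Finset.mem_filter, Finset.mem_univ, true_and, not_and, not_or]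
    exact fun _ => ⟨heT, hed.2⟩
  have hkd := hed
  rw [isDiagonal_mk_of_lt hk0, Fin.val_zero] at hkd
  obtain ⟨a, ha, hamax⟩ := (N.filter (· < k)).exists_max_image id
    ⟨⟨1, by omega⟩, by
      have hlt : (0 : Fin (n + 3)) < ⟨1, by omega⟩ := by simp
      simp only [N, Finset.mem_filter, Finset.mem_univ, true_and]
      refine ⟨⟨hlt, .inr ?_⟩, Fin.lt_def.2 hkd.1⟩
      rw [isSide_mk_of_lt hlt]
      simp⟩
  obtain ⟨b, hb, hbmin⟩ := (N.filter (k < ·)).exists_min_image id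
    ⟨⟨n + 2, by omega⟩, by
      have hlt : (0 : Fin (n + 3)) < ⟨n + 2, by omega⟩ := by simp [Fin.lt_def]
      simp only [N, Finset.mem_filter, Finset.mem_univ, true_and]
      refine ⟨⟨hlt, .inr ?_⟩, by simp only [Fin.lt_def]; omega⟩
      rw [isSide_mk_of_lt hlt]
      simp⟩
  rw [Finset.mem_filter] at ha hb
  have gap : ∀ c, a < c → c < b → c ∉ N := by
    intro c hac hcb hcN
    rcases lt_trichotomy c k with hck | rfl | hck
    · exact absurd (hamax c (Finset.mem_filter.2 ⟨hcN, hck⟩)) (not_le.2 hac)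
    · exact hkN hcN
    · exact absurd (hbmin c (Finset.mem_filter.2 ⟨hcN, hck⟩)) (not_le.2 hcb)
  have haN := ha.1
  have hbN := hb.1
  simp only [N, Finset.mem_filter, Finset.mem_univ, true_and] at haN hbN gap
  have hak := ha.2
  have hkb := hb.2
  have hab : a.val + 1 < b.val := by simp only [Fin.lt_def] at hak hkb; omega
  have habT : s(a, b) ∈ T := by
    refine hT.mem_of_not_crosses ?_ fun f hf hcr => ?_
    · rw [isDiagonal_mk_of_lt (hak.trans hkb)]
      have := haN.1
      simp only [Fin.lt_def, Fin.val_zero] at this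
      omega
    obtain ⟨x, y, hxy, rfl⟩ := exists_mk_of_not_isDiag (hT.prop.1 f hf).1
    have h1 := hT.not_crosses hf haN.2
    have h2 := hT.not_crosses hf hbN.2
    rw [crosses_mk_of_lt hxy haN.1] at h1
    rw [crosses_mk_of_lt hxy hbN.1] at h2
    rw [crosses_mk_of_lt (hak.trans hkb) hxy] at hcr
    have hx : x = 0 ∧ a < y ∧ y < b := by
      have := haN.1
      clear gap hamax hbmin
      simp only [Fin.lt_def, Fin.ext_iff, Fin.val_zero] at *
      omega
    obtain ⟨rfl, hay, hyb⟩ := hx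
    exact gap y hay hyb ⟨hxy, .inl hf⟩
  obtain ⟨c, hac, hcb, hacT, hcbT⟩ := hT.exists_triangle hab habT
  have ha0 := haN.1
  refine ⟨_, ⟨a, c, b, 0, ?_, habT, hacT, hcbT, ?_, haN.2, rfl⟩, ?_⟩
  · rw [crosses_mk]
    exact .inr (.inr (.inr (.inr (.inr (.inr (.inl ⟨ha0, hac, hcb⟩))))))
  · rw [Sym2.eq_swap]
    exact hbN.2
  · refine Set.ncard_lt_ncard ?_ (Set.toFinite _)
    rw [Set.ssubset_iff_of_subset]
    · refine ⟨c, fun hc => gap c hac hcb ⟨ha0.trans hac, .inl hc⟩, fun hc => hc (.inl ?_)⟩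
      exact Sym2.eq_swap
    · intro i hi hiT
      refine hi (.inr ⟨hiT, ?_⟩)
      rw [Set.mem_singleton_iff, Sym2.eq_iff]
      rintro (⟨h, -⟩ | ⟨h, -⟩)
      · exact ha0.ne h
      · exact (ha0.trans (hac.trans hcb)).ne h

theorem IsTriangulation.reach_fan {n : ℕ} {T : Set (Sym2 (Fin (n + 3)))}
    (hT : IsTriangulation T) : Relation.ReflTransGen Flip T (fan n) := by
  induction hk : fanDefect T using Nat.strong_induction_on generalizing T with
  | _ k ih =>
    by_cases h : fan n ⊆ T
    · rw [hT.eq_fan h]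
    · obtain ⟨T', hflip, hlt⟩ := hT.exists_flip h
      exact .head hflip (ih _ (hk ▸ hlt) (hT.flip hflip) rfl)

/-! ### Evaluation of rational functions -/

open MvPolynomial in
/-- The rational function `u` is defined at the point `g` and takes the value `c` there. -/
def HasValue {σ : Type*} (u : FractionRing (MvPolynomial σ ℚ)) (g : σ → ℚ) (c : ℚ) : Prop :=
  ∃ P Q : MvPolynomial σ ℚ, eval g Q ≠ 0 ∧ u * algebraMap _ _ Q = algebraMap _ _ P ∧
    eval g P = c * eval g Q

namespace HasValue
open MvPolynomial

variable {σ : Type*} {u v : FractionRing (MvPolynomial σ ℚ)} {g : σ → ℚ} {c d : ℚ}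

theorem algebraMap_X (i : σ) :
    HasValue (algebraMap (MvPolynomial σ ℚ) (FractionRing (MvPolynomial σ ℚ)) (X i)) g (g i) :=
  ⟨X i, 1, by simp, by simp, by simp⟩

theorem add (hu : HasValue u g c) (hv : HasValue v g d) : HasValue (u + v) g (c + d) := by
  obtain ⟨P, Q, hQ, h, hP⟩ := hu
  obtain ⟨P', Q', hQ', h', hP'⟩ := hv
  refine ⟨P * Q' + P' * Q, Q * Q', ?_, ?_, ?_⟩
  · rw [map_mul]; exact mul_ne_zero hQ hQ'
  · simp only [map_add, map_mul, ← h, ← h']; ring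
  · simp only [map_add, map_mul, hP, hP']; ring

theorem neg (hu : HasValue u g c) : HasValue (-u) g (-c) := by
  obtain ⟨P, Q, hQ, h, hP⟩ := hu
  exact ⟨-P, Q, hQ, by rw [map_neg, ← h, neg_mul], by rw [map_neg, hP, neg_mul]⟩

theorem sub (hu : HasValue u g c) (hv : HasValue v g d) : HasValue (u - v) g (c - d) := by
  rw [sub_eq_add_neg, sub_eq_add_neg]
  exact hu.add hv.neg

theorem mul (hu : HasValue u g c) (hv : HasValue v g d) : HasValue (u * v) g (c * d) := by
  obtain ⟨P, Q, hQ, h, hP⟩ := hu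
  obtain ⟨P', Q', hQ', h', hP'⟩ := hv
  refine ⟨P * P', Q * Q', ?_, ?_, ?_⟩
  · rw [map_mul]; exact mul_ne_zero hQ hQ'
  · simp only [map_mul, ← h, ← h']; ring
  · simp only [map_mul, hP, hP']; ring

theorem inv (hu : HasValue u g c) (hc : c ≠ 0) : HasValue u⁻¹ g c⁻¹ := by
  obtain ⟨P, Q, hQ, h, hP⟩ := hu
  have hP0 : eval g P ≠ 0 := hP ▸ mul_ne_zero hc hQ
  have hu0 : u ≠ 0 := by
    rintro rfl
    rw [zero_mul, eq_comm, FaithfulSMul.algebraMap_eq_zero_iff] at h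
    simp [h] at hP0
  exact ⟨Q, P, hP0, by rw [← h, inv_mul_cancel_left₀ hu0], by rw [hP, inv_mul_cancel_left₀ hc]⟩

theorem div (hu : HasValue u g c) (hv : HasValue v g d) (hd : d ≠ 0) :
    HasValue (u / v) g (c / d) := by
  rw [div_eq_mul_inv, div_eq_mul_inv]
  exact hu.mul (hv.inv hd)

theorem unique (hu : HasValue u g c) (hv : HasValue u g d) : c = d := by
  obtain ⟨P, Q, hQ, h, hP⟩ := hu
  obtain ⟨P', Q', hQ', h', hP'⟩ := hv
  have key : P * Q' = P' * Q := by
    apply FaithfulSMul.algebraMap_injective _ (FractionRing (MvPolynomial σ ℚ))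
    simp only [map_mul, ← h, ← h']
    ring
  have := congrArg (eval g) key
  simp only [map_mul, hP, hP'] at this
  refine mul_right_cancel₀ (mul_ne_zero hQ hQ') ?_
  linear_combination this

/-- A rational function that vanishes at all points with positive coordinates is zero. -/
theorem eq_zero (h : ∀ g : σ → ℚ, (∀ i, 0 < g i) → HasValue u g 0) : u = 0 := by
  obtain ⟨N, D, hD, rfl⟩ := IsFractionRing.div_surjective (A := MvPolynomial σ ℚ) u
  have hD0 : algebraMap _ (FractionRing (MvPolynomial σ ℚ)) D ≠ 0 := by
    rw [Ne, FaithfulSMul.algebraMap_eq_zero_iff]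
    exact nonZeroDivisors.ne_zero hD
  suffices N = 0 by simp [this]
  refine funext_set (fun _ => Set.Ioi 0) (fun _ => Set.Ioi_infinite 0) fun g hg => ?_
  obtain ⟨P, Q, hQ, h, hP⟩ := h g fun i => hg i trivial
  -- Both fractions represent `u`; evaluating at `g`, where `P` vanishes and `Q` does not, forces
  -- `N` to vanish.
  have key : N * Q = P * D := by
    apply FaithfulSMul.algebraMap_injective _ (FractionRing (MvPolynomial σ ℚ))
    rw [map_mul, map_mul, ← h]
    field_simp
  have := congrArg (eval g) key
  rw [map_mul, map_mul, hP, zero_mul, zero_mul] at this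
  rw [map_zero]
  exact (mul_eq_zero.1 this).resolve_right hQ

theorem eq_of_forall_pos (h : ∀ g : σ → ℚ, (∀ i, 0 < g i) → ∃ c, HasValue u g c ∧ HasValue v g c) :
    u = v := by
  refine sub_eq_zero.1 (eq_zero fun g hg => ?_)
  obtain ⟨c, hu, hv⟩ := h g hg
  simpa using hu.sub hv

end HasValue

/-! ### Ptolemy lengths with prescribed values on a triangulation -/

/-- A system of positive lengths of the chords of a polygon that satisfies the Ptolemy relations. -/
structure IsPtolemy {m : ℕ} (G : Sym2 (Fin m) → ℚ) : Prop where
  pos : ∀ a b, a < b → 0 < G s(a, b)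
  rel : ∀ a b c d, a < b → b < c → c < d →
    G s(a, c) * G s(b, d) = G s(a, b) * G s(c, d) + G s(b, c) * G s(a, d)

theorem IsPtolemy.pos_of_ne {m : ℕ} {G : Sym2 (Fin m) → ℚ} (hG : IsPtolemy G) {a b : Fin m}
    (h : a ≠ b) : 0 < G s(a, b) := by
  rcases lt_or_gt_of_ne h with h | h
  · exact hG.pos a b h
  · rw [Sym2.eq_swap]; exact hG.pos b a h

theorem Crosses.ne {m : ℕ} {p q r t : Fin m} (h : Crosses s(p, r) s(q, t)) : p ≠ r := by
  rw [crosses_mk] at h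
  simp only [Fin.lt_def, ne_eq, Fin.ext_iff] at *
  omega

theorem IsPtolemy.rel_of_crosses {m : ℕ} {G : Sym2 (Fin m) → ℚ} (hG : IsPtolemy G)
    {p q r t : Fin m} (h : Crosses s(p, r) s(q, t)) :
    G s(p, r) * G s(q, t) = G s(p, q) * G s(r, t) + G s(q, r) * G s(t, p) := by
  have e : ∀ x y, G s(x, y) = G s(y, x) := fun x y => by rw [Sym2.eq_swap]
  rw [crosses_mk] at h
  rcases h with ⟨ha, hb, hc⟩ | ⟨ha, hb, hc⟩ | ⟨ha, hb, hc⟩ | ⟨ha, hb, hc⟩ | ⟨ha, hb, hc⟩ |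
    ⟨ha, hb, hc⟩ | ⟨ha, hb, hc⟩ | ⟨ha, hb, hc⟩ <;>
  · have key := hG.rel _ _ _ _ ha hb hc
    simp only [e q p, e r p, e t p, e r q, e t q, e t r] at key ⊢
    linarith

/-- Lengths from the `2 × 2` minors of a matrix with two rows. -/
theorem exists_isPtolemy {m : ℕ} (u w : Fin m → ℚ) (h : ∀ i j, i < j → 0 < u i * w j - u j * w i) :
    ∃ G : Sym2 (Fin m) → ℚ, IsPtolemy G ∧ ∀ i j, i < j → G s(i, j) = u i * w j - u j * w i := by
  let G : Sym2 (Fin m) → ℚ := Sym2.lift ⟨fun i j => |u i * w j - u j * w i|, fun i j => by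
    exact abs_sub_comm _ _⟩
  have hG : ∀ i j, i < j → G s(i, j) = u i * w j - u j * w i := fun i j hij => by
    simp only [G, Sym2.lift_mk]
    exact abs_of_pos (h i j hij)
  refine ⟨G, ⟨fun a b hab => by rw [hG a b hab]; exact h a b hab, fun a b c d hab hbc hcd => ?_⟩, hG⟩
  rw [hG _ _ (hab.trans hbc), hG _ _ (hbc.trans hcd), hG _ _ hab, hG _ _ hcd, hG _ _ hbc,
    hG _ _ ((hab.trans hbc).trans hcd)]
  -- The three-term Plücker relation.
  ring

/-- Every positive assignment to the chords of `S` and the sides extends to Ptolemy lengths. -/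
def Extendable {n : ℕ} (S : Set (Sym2 (Fin (n + 3)))) : Prop :=
  ∀ g : Sym2 (Fin (n + 3)) → ℚ, (∀ e, 0 < g e) →
    ∃ G, IsPtolemy G ∧ ∀ e, (e ∈ S ∨ IsSide e) → G e = g e

/-- Columns `(1, 0)` at vertex `0` and `(-l i * t i, l i)` elsewhere have minors `l j` and `l i * l
j * (t j - t i)`. The `l` are the prescribed spokes, and the increments `y` of `t` are solved from
the sides; the side from `0` to `n + 2` counts as a spoke. -/
theorem extendable_fan (n : ℕ) : Extendable (fan n) := by
  intro g hg
  let l : ℕ → ℚ := fun i => g s(0, (Fin.ofNat (n + 3) i))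
  let y : ℕ → ℚ := fun i => g s(Fin.ofNat (n + 3) i, Fin.ofNat (n + 3) (i + 1)) / (l i * l (i + 1))
  have hl : ∀ i, 0 < l i := fun i => hg _
  have hy : ∀ i, 0 < y i := fun i => div_pos (hg _) (mul_pos (hl _) (hl _))
  let t : ℕ → ℚ := fun i => ∑ k ∈ Finset.range i, y k
  have ht : StrictMono t := strictMono_nat_of_lt_succ fun i => by
    simp only [t, Finset.sum_range_succ]
    linarith [hy i]
  let u : Fin (n + 3) → ℚ := fun i => if i = 0 then 1 else - (l i * t i)
  let w : Fin (n + 3) → ℚ := fun i => if i = 0 then 0 else l i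
  have h0 : ∀ j, 0 < j → u 0 * w j - u j * w 0 = l j := fun j hj => by
    simp [u, w, hj.ne']
  have h1 : ∀ i j, 0 < i → i < j → u i * w j - u j * w i = l i * l j * (t j - t i) :=
    fun i j hi hj => by
      simp only [u, w, hi.ne', (hi.trans hj).ne', if_false]
      ring
  obtain ⟨G, hG, hGv⟩ := exists_isPtolemy u w (fun i j hij => by
    rcases eq_or_ne i 0 with rfl | hi
    · rw [h0 j hij]
      exact hl _
    · rw [h1 i j (Fin.pos_iff_ne_zero.2 hi) hij]
      exact mul_pos (mul_pos (hl _) (hl _)) (sub_pos.2 (ht hij)))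
  have fan_val : ∀ j, 0 < j → G s(0, j) = g s(0, j) := fun j hj => by
    rw [hGv 0 j hj, h0 j hj]
    simp [l]
  refine ⟨G, hG, fun e he => ?_⟩
  have hne : ¬ e.IsDiag := he.elim (fun h => h.1.1) IsSide.not_isDiag
  obtain ⟨a, b, hab, rfl⟩ := exists_mk_of_not_isDiag hne
  rcases eq_or_ne a 0 with rfl | ha
  · exact fan_val b hab
  · have ha' := Fin.pos_iff_ne_zero.2 ha
    have hb : b.val = a.val + 1 := by
      rcases he with he | he
      · rcases Sym2.mem_iff.1 he.2 with h | h
        · exact absurd h.symm ha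
        · exact absurd h (ha'.trans hab).ne
      · rw [isSide_mk_of_lt hab] at he
        exact he.resolve_right fun h => ha (Fin.ext h.1)
    have e1 : Fin.ofNat (n + 3) (a.val + 1) = b := by rw [← hb]; simp
    rw [hGv a b hab, h1 a b ha' hab]
    have : t b - t a = y a := by simp [t, hb, Finset.sum_range_succ]
    rw [this, hb]
    simp only [y]
    rw [mul_div_cancel₀ _ (mul_pos (hl _) (hl _)).ne', e1]
    simp

/-- Prescribe on `qt` the value `z` dictated by the exchange relation; the Ptolemy relation then
returns the given value on `pr`. -/
theorem Extendable.of_flip {n : ℕ} {S S' : Set (Sym2 (Fin (n + 3)))} (hS : IsTriangulation S)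
    (h : Flip S S') (hS' : Extendable S') : Extendable S := by
  classical
  obtain ⟨p, q, r, t, hc, hpr, hpq, hqr, hrt, htp, rfl⟩ := h
  intro g hg
  let z := (g s(p, q) * g s(r, t) + g s(q, r) * g s(t, p)) / g s(p, r)
  have hz : 0 < z :=
    div_pos (add_pos (mul_pos (hg _) (hg _)) (mul_pos (hg _) (hg _))) (hg _)
  obtain ⟨G, hG, hGv⟩ := hS' (Function.update g s(q, t) z) fun e => by
    rw [Function.update_apply]
    split_ifs
    exacts [hz, hg e]
  have hne : (s(p, q) ≠ s(p, r) ∧ s(q, r) ≠ s(p, r) ∧ s(r, t) ≠ s(p, r) ∧ s(t, p) ≠ s(p, r)) := by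
    have := hc
    rw [crosses_mk] at this
    simp only [ne_eq, Sym2.eq_iff, Fin.lt_def, Fin.ext_iff] at this ⊢
    omega
  have old : ∀ e, e ≠ s(p, r) → (e ∈ S ∨ IsSide e) → G e = g e := fun e h1 h2 => by
    rw [hGv e (h2.imp_left fun h => .inr ⟨h, h1⟩), Function.update_of_ne]
    rintro rfl
    exact hS.not_crosses hpr h2 hc
  have new : G s(q, t) = z := by
    rw [hGv _ (.inl (.inl rfl)), Function.update_self]
  refine ⟨G, hG, fun e he => ?_⟩
  by_cases hepr : e = s(p, r)
  · have rel := hG.rel_of_crosses hc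
    rw [old _ hne.1 hpq, old _ hne.2.1 hqr, old _ hne.2.2.1 hrt, old _ hne.2.2.2 htp, new] at rel
    rw [hepr]
    refine mul_right_cancel₀ hz.ne' (rel.trans ?_)
    rw [mul_div_cancel₀ _ (hg _).ne']
  · exact old e hepr he

theorem IsTriangulation.extendable {n : ℕ} {T : Set (Sym2 (Fin (n + 3)))}
    (hT : IsTriangulation T) : Extendable T := by
  have h := hT.reach_fan
  induction h using Relation.ReflTransGen.head_induction_on with
  | refl => exact extendable_fan n
  | head h _ ih => exact .of_flip hT h (ih (hT.flip h))

/-! ### One cluster variable for each diagonal -/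

/-- The value of every variable of a seed at a system of Ptolemy lengths. -/
theorem IsSeed.hasValue {n : ℕ} {T S : Set (Sym2 (Fin (n + 3)))}
    {f : Sym2 (Fin (n + 3)) → AmbientField T} (h : IsSeed T S f) {G : Sym2 (Fin (n + 3)) → ℚ}
    (hG : IsPtolemy G) : ∀ e, (e ∈ S ∨ IsSide e) → HasValue (f e) (fun i => G i.1) (G e) := by
  induction h with
  | initial =>
    intro e he
    rw [initialVars, dif_pos he]
    exact HasValue.algebraMap_X (g := fun i : {e // e ∈ T ∨ IsSide e} => G i.1) ⟨e, he⟩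
  | flip S f p q r t hS hc hpr hpq hqr hrt htp ih =>
    intro e he
    by_cases heq : e = s(q, t)
    · subst heq
      rw [Function.update_self]
      have h0 : G s(p, r) ≠ 0 := (hG.pos_of_ne hc.ne).ne'
      rw [eq_div_of_mul_eq h0 ((mul_comm _ _).trans (hG.rel_of_crosses hc))]
      exact ((((ih _ hpq).mul (ih _ hrt)).add ((ih _ hqr).mul (ih _ htp))).div (ih _ (.inl hpr)) h0)
    · rw [Function.update_of_ne heq]
      exact ih e (he.imp_left fun h => (h.resolve_left heq).1)

theorem IsClusterVariable.hasValue {n : ℕ} {T : Set (Sym2 (Fin (n + 3)))} {α : Sym2 (Fin (n + 3))}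
    {u : AmbientField T} (h : IsClusterVariable T α u) {G : Sym2 (Fin (n + 3)) → ℚ}
    (hG : IsPtolemy G) : HasValue u (fun i => G i.1) (G α) := by
  obtain ⟨S, f, hS, hα, rfl⟩ := h
  exact hS.hasValue hG α (.inl hα)

theorem IsTriangulation.isClusterVariable_unique {n : ℕ} {T : Set (Sym2 (Fin (n + 3)))}
    (hT : IsTriangulation T) {α : Sym2 (Fin (n + 3))} {u v : AmbientField T}
    (hu : IsClusterVariable T α u) (hv : IsClusterVariable T α v) : u = v := by
  classical
  refine HasValue.eq_of_forall_pos fun g hg => ?_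
  -- The default `1` only keeps the assignment positive.
  obtain ⟨G, hG, hGv⟩ := hT.extendable (fun e => if h : e ∈ T ∨ IsSide e then g ⟨e, h⟩ else 1)
    fun e => by
      split_ifs
      exacts [hg _, one_pos]
  have : g = fun i => G i.1 := by
    ext i
    rw [hGv _ i.2, dif_pos i.2]
  rw [this]
  exact ⟨_, hu.hasValue hG, hv.hasValue hG⟩

theorem IsSeed.exists_of_reach {n : ℕ} {T S : Set (Sym2 (Fin (n + 3)))}
    (h : Relation.ReflTransGen Flip T S) : ∃ f, IsSeed T S f := by
  induction h with
  | refl => exact ⟨_, .initial⟩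
  | tail _ hf ih =>
    obtain ⟨f, hS⟩ := ih
    obtain ⟨p, q, r, t, hc, hpr, hpq, hqr, hrt, htp, rfl⟩ := hf
    exact ⟨_, .flip _ f p q r t hS hc hpr hpq hqr hrt htp⟩

theorem mem_fan {n : ℕ} {j : Fin (n + 3)} (h1 : 1 < j.val) (h2 : j.val < n + 2) :
    s(0, j) ∈ fan n := by
  refine ⟨?_, Sym2.mem_mk_left _ _⟩
  rw [isDiagonal_mk_of_lt (Fin.lt_def.2 (by rw [Fin.val_zero]; omega))]
  simp only [Fin.val_zero]
  omega

/-- Flipping the diagonals of the fan from `s(0, a + 1)` on produces the diagonal `s(a, b)`. -/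
theorem exists_reach_of_fan {n : ℕ} (a : Fin (n + 3)) (ha : 0 < a) :
    ∀ (b : ℕ) (_ : a.val + 1 < b) (hb : b < n + 3), ∃ S, Relation.ReflTransGen Flip (fan n) S ∧
      s(a, ⟨b, hb⟩) ∈ S ∧
      ∀ j : Fin (n + 3), (j ≤ a ∨ b ≤ j.val) → s(0, j) ∈ fan n → s(0, j) ∈ S := by
  have ha' : 0 < a.val := ha
  have hside : ∀ (x y : Fin (n + 3)), y.val = x.val + 1 → IsSide s(x, y) := fun x y h => by
    rw [isSide_mk_of_lt (by simp only [Fin.lt_def]; omega)]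
    exact .inl h
  have hspoke : ∀ j : Fin (n + 3), 0 < j.val → s(0, j) ∈ fan n ∨ IsSide s(0, j) := fun j hj => by
    by_cases h : 1 < j.val ∧ j.val < n + 2
    · exact .inl (mem_fan h.1 h.2)
    · right
      rw [isSide_mk_of_lt (Fin.lt_def.2 hj)]
      have h0 : (0 : Fin (n + 3)).val = 0 := rfl
      omega
  -- One step: the flip of the spoke `s(0, c)` inside `0, a, c, c + 1`.
  have step : ∀ (S : Set (Sym2 (Fin (n + 3)))) (c : ℕ) (hc : c + 1 < n + 3), a.val < c →
      Relation.ReflTransGen Flip (fan n) S →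
      (s(a, ⟨c, by omega⟩) ∈ S ∨ IsSide s(a, ⟨c, by omega⟩)) →
      (∀ j : Fin (n + 3), (j ≤ a ∨ c ≤ j.val) → s(0, j) ∈ fan n → s(0, j) ∈ S) →
      ∃ S, Relation.ReflTransGen Flip (fan n) S ∧ s(a, ⟨c + 1, hc⟩) ∈ S ∧
        ∀ j : Fin (n + 3), (j ≤ a ∨ c + 1 ≤ j.val) → s(0, j) ∈ fan n → s(0, j) ∈ S := by
    intro S c hc hac hS haS hfan
    refine ⟨_, hS.tail ⟨0, a, ⟨c, by omega⟩, ⟨c + 1, hc⟩, ?_, ?_, ?_, haS, ?_, ?_, rfl⟩,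
      .inl rfl, ?_⟩
    · rw [crosses_mk]
      left
      simp only [Fin.lt_def, Fin.val_zero]
      omega
    · exact hfan _ (.inr le_rfl) (mem_fan (by simp only; omega) (by simp only; omega))
    · exact (hspoke a ha').imp_left (hfan a (.inl le_rfl))
    · exact .inr (hside _ _ rfl)
    · rw [Sym2.eq_swap]
      exact (hspoke ⟨c + 1, hc⟩ (by simp)).imp_left (hfan _ (.inr (by simp)))
    · intro j hj hjf
      refine .inr ⟨hfan j (hj.imp_right fun h => by omega) hjf, ?_⟩
      rw [Set.mem_singleton_iff, Sym2.eq_iff]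
      have hj' : j.val ≤ a.val ∨ c + 1 ≤ j.val := hj
      simp only [Fin.ext_iff, Fin.val_zero]
      omega
  intro b hab
  induction b, hab using Nat.le_induction with
  | base =>
    intro hb
    exact step _ (a.val + 1) hb (by omega) .refl (.inr (hside _ _ rfl)) fun _ _ h => h
  | succ c hac ih =>
    intro hb
    obtain ⟨S, hS, haS, hfan⟩ := ih (by omega)
    exact step S c hb (by omega) hS (.inl haS) hfan

theorem IsTriangulation.exists_isClusterVariable {n : ℕ} {T : Set (Sym2 (Fin (n + 3)))}
    (hT : IsTriangulation T) {α : Sym2 (Fin (n + 3))} (hα : IsDiagonal α) :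
    ∃ u, IsClusterVariable T α u := by
  obtain ⟨S, hS, hαS⟩ : ∃ S, Relation.ReflTransGen Flip (fan n) S ∧ α ∈ S := by
    obtain ⟨a, b, hab, rfl⟩ := exists_mk_of_not_isDiag hα.1
    rcases eq_or_ne a 0 with rfl | ha
    · exact ⟨_, .refl, hα, Sym2.mem_mk_left _ _⟩
    · obtain ⟨S, hS, h, -⟩ := exists_reach_of_fan a (Fin.pos_iff_ne_zero.2 ha) b.val
        ((isDiagonal_mk_of_lt hab).1 hα).1 b.isLt
      exact ⟨S, hS, h⟩
  obtain ⟨f, hf⟩ := IsSeed.exists_of_reach (hT.reach_fan.trans hS)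
  exact ⟨f α, S, f, hf, hαS, rfl⟩


/-- Existence and uniqueness combined, so that later arguments use one function `x` in place of
seeds. -/
theorem IsTriangulation.exists_variables {n : ℕ} {T : Set (Sym2 (Fin (n + 3)))}
    (hT : IsTriangulation T) :
    ∃ x : Sym2 (Fin (n + 3)) → AmbientField T,
      ∀ α u, IsDiagonal α → (IsClusterVariable T α u ↔ u = x α) := by
  classical
  refine ⟨fun α => if h : IsDiagonal α then (hT.exists_isClusterVariable h).choose else 0,
    fun α u hα => ?_⟩
  have hx := (hT.exists_isClusterVariable hα).choose_spec
  simp only [dif_pos hα]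
  constructor
  · intro hu
    exact hT.isClusterVariable_unique hu hx
  · rintro rfl
    exact hx

/-! ### Counting the generators -/

/-- The increasing triples `i < j < k` index the pairs of crossing diagonals `s(0, j)`,
`s(i, k)`, where the vertices other than `0` are numbered from `0` on. -/
theorem firstVertexDifferences_eq_range {n : ℕ} {T : Set (Sym2 (Fin (n + 3)))}
    {x : Sym2 (Fin (n + 3)) → AmbientField T}
    (hx : ∀ α u, IsDiagonal α → (IsClusterVariable T α u ↔ u = x α)) :
    firstVertexDifferences T = Set.range fun f : Fin 3 ↪o Fin (n + 2) =>
      x s(0, (f 1).succ) - x s((f 0).succ, (f 2).succ) := by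
  ext w
  constructor
  · rintro ⟨α, β, u, v, h0, hc, hu, hv, rfl⟩
    rw [hx α u hc.isDiagonal_left] at hu
    rw [hx β v hc.symm.isDiagonal_left] at hv
    subst hu hv
    obtain ⟨a, b, c, d, hab, hbc, hcd, ⟨rfl, rfl⟩ | ⟨rfl, rfl⟩⟩ := hc
    · have ha : a = 0 := by
        rcases Sym2.mem_iff.1 h0 with h | h
        · exact h.symm
        · exact absurd (h ▸ hab.trans hbc) (Fin.not_lt_zero a)
      subst ha
      obtain ⟨b', rfl⟩ := Fin.exists_succ_eq.2 hab.ne'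
      obtain ⟨c', rfl⟩ := Fin.exists_succ_eq.2 (hab.trans hbc).ne'
      obtain ⟨d', rfl⟩ := Fin.exists_succ_eq.2 ((hab.trans hbc).trans hcd).ne'
      rw [Fin.succ_lt_succ_iff] at hbc hcd
      have hmono : StrictMono ![b', c', d'] := by
        rw [Fin.strictMono_iff_lt_succ]
        intro i
        fin_cases i
        · exact hbc
        · exact hcd
      exact ⟨OrderEmbedding.ofStrictMono _ hmono, rfl⟩
    · exfalso
      rcases Sym2.mem_iff.1 h0 with h | h
      · exact Fin.not_lt_zero a (h ▸ hab)
      · exact Fin.not_lt_zero a (h ▸ (hab.trans hbc).trans hcd)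
  · rintro ⟨f, rfl⟩
    have h01 : (f 0).succ < (f 1).succ := Fin.succ_lt_succ_iff.2 (f.strictMono (by decide))
    have h12 : (f 1).succ < (f 2).succ := Fin.succ_lt_succ_iff.2 (f.strictMono (by decide))
    have hc : Crosses s(0, (f 1).succ) s((f 0).succ, (f 2).succ) :=
      ⟨_, _, _, _, Fin.succ_pos _, h01, h12, .inl ⟨rfl, rfl⟩⟩
    exact ⟨_, _, _, _, Sym2.mem_mk_left _ _, hc, (hx _ _ hc.isDiagonal_left).2 rfl,
      (hx _ _ hc.symm.isDiagonal_left).2 rfl, rfl⟩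

theorem four_pow_lt {a b : ℕ} (h : a < b) : 4 * 4 ^ a ≤ 4 ^ b := by
  rw [← pow_succ']
  exact Nat.pow_le_pow_right (by norm_num) h

/-- The number `4 ^ k - 4 ^ j - 4 ^ i` is below `4 ^ k` and above `4 ^ k / 4`, which fixes `k`; then
`4 ^ j` dominates `4 ^ i`, which fixes `j`. -/
theorem four_pow_add_injective {i j k i' j' k' : ℕ} (hij : i < j) (hjk : j < k) (hij' : i' < j')
    (hjk' : j' < k') (h : 4 ^ j + 4 ^ i + 4 ^ k' = 4 ^ j' + 4 ^ i' + 4 ^ k) :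
    i = i' ∧ j = j' ∧ k = k' := by
  have p : ∀ a, 0 < 4 ^ a := fun a => by positivity
  have a1 := four_pow_lt hij
  have a2 := four_pow_lt hjk
  have a3 := four_pow_lt hij'
  have a4 := four_pow_lt hjk'
  have hk : k = k' := by
    rcases lt_trichotomy k k' with hlt | heq | hlt
    · have := four_pow_lt hlt
      have := p i
      omega
    · exact heq
    · have := four_pow_lt hlt
      have := p i'
      omega
  subst hk
  have hj : j = j' := by
    rcases lt_trichotomy j j' with hlt | heq | hlt
    · have := four_pow_lt hlt
      have := p i'
      omega
    · exact heq
    · have := four_pow_lt hlt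
      have := p i
      omega
  subst hj
  exact ⟨Nat.pow_right_injective (by norm_num : 2 ≤ 4) (by simp only; omega), rfl, rfl⟩

theorem differences_injective {n : ℕ} {T : Set (Sym2 (Fin (n + 3)))}
    {x : Sym2 (Fin (n + 3)) → AmbientField T}
    (hx : ∀ α u, IsDiagonal α → (IsClusterVariable T α u ↔ u = x α)) :
    Function.Injective fun f : Fin 3 ↪o Fin (n + 2) =>
      x s(0, (f 1).succ) - x s((f 0).succ, (f 2).succ) := by
  -- At the lengths `4 ^ j - 4 ^ i` the difference for `i < j < k` takes the value `4 ^ j + 4 ^ i -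
  -- 4 ^ k - 1`, with polygon labels as exponents (hence the `+ 1` below).
  obtain ⟨G, hG, hGv⟩ := exists_isPtolemy (m := n + 3) (fun _ => 1) (fun i => 4 ^ i.val)
    fun i j hij => by
      have := pow_lt_pow_right₀ (by norm_num : (1 : ℚ) < 4) hij
      linarith
  have val : ∀ f : Fin 3 ↪o Fin (n + 2),
      f 0 < f 1 ∧ f 1 < f 2 ∧ HasValue (x s(0, (f 1).succ) - x s((f 0).succ, (f 2).succ))
        (fun i => G i.1) (4 ^ ((f 1).val + 1) - 1 - (4 ^ ((f 2).val + 1) - 4 ^ ((f 0).val + 1))) := by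
    intro f
    have h01 : f 0 < f 1 := f.strictMono (by decide)
    have h12 : f 1 < f 2 := f.strictMono (by decide)
    have hc : Crosses s(0, (f 1).succ) s((f 0).succ, (f 2).succ) :=
      ⟨_, _, _, _, Fin.succ_pos _, Fin.succ_lt_succ_iff.2 h01, Fin.succ_lt_succ_iff.2 h12,
        .inl ⟨rfl, rfl⟩⟩
    refine ⟨h01, h12, ?_⟩
    have h := (((hx _ _ hc.isDiagonal_left).2 rfl).hasValue hG).sub
      (((hx _ _ hc.symm.isDiagonal_left).2 rfl).hasValue hG)
    rw [hGv _ _ (Fin.succ_pos _), hGv _ _ (Fin.succ_lt_succ_iff.2 (h01.trans h12))] at h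
    simpa using h
  intro f f' hff
  obtain ⟨h1, h2, hv⟩ := val f
  obtain ⟨h1', h2', hv'⟩ := val f'
  dsimp only at hff
  rw [hff] at hv
  have key := hv.unique hv'
  obtain ⟨e0, e1, e2⟩ := four_pow_add_injective (Nat.succ_lt_succ h1) (Nat.succ_lt_succ h2)
    (Nat.succ_lt_succ h1') (Nat.succ_lt_succ h2') (by
      have : ((4 ^ ((f 1).val + 1) + 4 ^ ((f 0).val + 1) + 4 ^ ((f' 2).val + 1) : ℕ) : ℚ) =
          (4 ^ ((f' 1).val + 1) + 4 ^ ((f' 0).val + 1) + 4 ^ ((f 2).val + 1) : ℕ) := by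
        push_cast
        linarith
      exact_mod_cast this)
  ext i
  fin_cases i
  · exact Nat.succ_injective e0
  · exact Nat.succ_injective e1
  · exact Nat.succ_injective e2

theorem encard_firstVertexDifferences {n : ℕ} {T : Set (Sym2 (Fin (n + 3)))}
    (hT : IsTriangulation T) :
    (firstVertexDifferences T).encard = ((n + 2).choose 3 : ℕ) := by
  obtain ⟨x, hx⟩ := hT.exists_variables
  -- Order embeddings of `Fin 3` correspond to three-element subsets.
  rw [firstVertexDifferences_eq_range hx, ← Set.image_univ,
    (differences_injective hx).encard_image, Set.encard_univ, ENat.card_congr Set.powersetCard.ofFinEmbEquiv,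
    ENat.card_eq_coe_natCard, Set.powersetCard.card, Nat.card_fin]

/-! ### Generation and freeness -/

theorem span_firstVertexDifferences {n : ℕ} {T : Set (Sym2 (Fin (n + 3)))}
    (hT : IsTriangulation T) :
    Submodule.span ℤ (firstVertexDifferences T) = exchangeModule T := by
  obtain ⟨x, hx⟩ := hT.exists_variables
  apply le_antisymm
  · exact Submodule.span_mono fun w ⟨α, β, u, v, _, h⟩ => ⟨α, β, u, v, h⟩
  have base : ∀ i j k : Fin (n + 3), 0 < i → i < j → j < k →
      x s(0, j) - x s(i, k) ∈ Submodule.span ℤ (firstVertexDifferences T) := by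
    intro i j k hi hij hjk
    have hc : Crosses s(0, j) s(i, k) := ⟨0, i, j, k, hi, hij, hjk, .inl ⟨rfl, rfl⟩⟩
    exact Submodule.subset_span ⟨_, _, _, _, Sym2.mem_mk_left _ _, hc,
      (hx _ _ hc.isDiagonal_left).2 rfl, (hx _ _ hc.symm.isDiagonal_left).2 rfl, rfl⟩
  have main : ∀ a b c d : Fin (n + 3), a < b → b < c → c < d →
      x s(a, c) - x s(b, d) ∈ Submodule.span ℤ (firstVertexDifferences T) := by
    intro a b c d hab hbc hcd
    rcases eq_or_ne a 0 with rfl | ha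
    · exact base b c d hab hbc hcd
    have ha := Fin.pos_iff_ne_zero.2 ha
    have h1 := base a b c ha hab hbc
    have h2 := base a b d ha hab (hbc.trans hcd)
    have h3 := base a c d ha (hab.trans hbc) hcd
    have h4 := base b c d (ha.trans hab) hbc hcd
    -- `x_0b` cancels to give `x_ac - x_ad`, and `x_0c` cancels to give `x_ad - x_bd`.
    convert! add_mem (sub_mem h2 h1) (sub_mem h4 h3) using 1
    ring
  refine Submodule.span_le.2 ?_
  rintro w ⟨α, β, u, v, hc, hu, hv, rfl⟩
  rw [hx α u hc.isDiagonal_left] at hu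
  rw [hx β v hc.symm.isDiagonal_left] at hv
  subst hu hv
  obtain ⟨a, b, c, d, hab, hbc, hcd, ⟨rfl, rfl⟩ | ⟨rfl, rfl⟩⟩ := hc
  · exact main a b c d hab hbc hcd
  · rw [← neg_sub]
    exact neg_mem (main a b c d hab hbc hcd)

end TypeA

theorem theorem1p3 (n : ℕ) (T : Set (Sym2 (Fin (n + 3)))) (hT : TypeA.IsTriangulation T) :
    Module.Free ℤ (TypeA.exchangeModule T) ∧
    Submodule.span ℤ (TypeA.firstVertexDifferences T) = TypeA.exchangeModule T ∧
    (TypeA.firstVertexDifferences T).encard = ((n + 2).choose 3 : ℕ) := by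
  have hspan := TypeA.span_firstVertexDifferences hT
  have hcard := TypeA.encard_firstVertexDifferences hT
  refine ⟨?_, hspan, hcard⟩
  have hfin : (TypeA.firstVertexDifferences T).Finite := by
    rw [← Set.encard_ne_top_iff, hcard]
    exact ENat.natCast_ne_top _
  rw [← hspan]
  have := Module.Finite.span_of_finite ℤ hfin
  -- Finitely generated and torsion-free over the principal ideal domain `ℤ`.
  infer_instance
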